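/- Let $A$ be a separable complex Hilbert space and let $H$ be a grounded Hamiltonian on $A$, that is, a (possibly unbounded) self-adjoint operator whose ground state energy $\inf\{\langle\psi|H|\psi\rangle : \psi\in\operatorname{dom}H,\ \|\psi\|=1\}$ is $0$ (so $H\ge 0$). Let $U_t=e^{-itH}$, i.e. the strongly continuous one-parameter unitary group with generator $-iH$, and let $\mathcal U(t)(\rho)=U_t\,\rho\,U_t^\dagger$. For a superoperator $\Delta$ from the trace class operators on $A$ to those on a Hilbert space $B$ and for $E\ge 0$, the $E$-constrained diamond norm with respect to $H$ is $$\|\Delta\|_{\diamond E}=\sup\bigl\{\|(\Delta\otimes\mathrm{id}_C)\rho\|_1 : C \text{ a separable Hilbert space},\ \rho \text{ a state on } A\otimes C,\ \operatorname{tr}\rho^A H\le E\bigr\},$$ where $\|\xi\|_1=\operatorname{tr}\sqrt{\xi^\dagger\xi}$ and $\rho^A=\operatorname{tr}_C\rho$. Then, for every $E\ge 0$: 1. for all $t\ge 0$, $\quad\frac12\,\|\mathcal U(t)-\mathcal U(0)\|_{\diamond E}\le\sqrt[3]{4tE}$, where $\mathcal U(0)=\mathrm{id}$; 2. $t\mapsto\mathcal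 U(t)$ is uniformly continuous in $\|\cdot\|_{\diamond E}$: for every $\varepsilon>0$ there is $\delta>0$ such that $\|\mathcal U(t)-\mathcal U(s)\|_{\diamond E}<\varepsilon$ for all $s,t\in\mathbb R$ with $|t-s|<\delta$; 3. (speed limit) if $\psi\in A$ is a unit vector with energy $\langle\psi|H|\psi\rangle\le E$ and $\langle\psi|U_t\psi\rangle=0$ for some $t\ge 0$, then $4tE\ge 1$, i.e. $t\ge\frac1{4E}$. -/

import Mathlib

open scoped ENNReal Topology TensorProduct InnerProductSpace
open Filter

noncomputable section

namespace QuantumSpeed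

universe u

section SingleSystem

variable {A : Type u} [NormedAddCommGroup A] [InnerProductSpace ℂ A] [CompleteSpace A]

/-- The index set of an orthonormal basis of the Hilbert space `A`. -/
def basisIndex (A : Type u) [NormedAddCommGroup A] [InnerProductSpace ℂ A] [CompleteSpace A] :
    Set A :=
  (exists_hilbertBasis ℂ A).choose

/-- An orthonormal basis (in the Hilbert space sense) of `A`. The quantities defined with it below
do not depend on the choice. -/
def onb (A : Type u) [NormedAddCommGroup A] [InnerProductSpace ℂ A] [CompleteSpace A] :
    HilbertBasis (basisIndex A) ℂ A :=
  (exists_hilbertBasis ℂ A).choose_spec.choose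

/-- The trace `∑ᵢ ⟨eᵢ, P eᵢ⟩ ∈ [0, ∞]` of a positive operator `P`. -/
def posTrace (P : A →L[ℂ] A) : ℝ≥0∞ :=
  ∑' i, ENNReal.ofReal (⟪onb A i, P (onb A i)⟫_ℂ).re

/-- The trace norm `‖T‖₁ = tr √(T† T) ∈ [0, ∞]`; `T` is trace class iff it is finite. -/
def traceNorm (T : A →L[ℂ] A) : ℝ≥0∞ :=
  posTrace (CFC.sqrt (star T * T))

/-- States, that is density operators: positive operators of trace one. -/
structure IsState (ρ : A →L[ℂ] A) : Prop where
  isPositive : ρ.IsPositive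
  posTrace_eq_one : posTrace ρ = 1

/-- A grounded Hamiltonian: a self-adjoint (in general unbounded, densely defined) operator `H`
whose ground state energy, i.e. the infimum of `⟨ψ, H ψ⟩` over the unit vectors `ψ` in the domain
of `H`, is `0`. In particular `H ≥ 0`. -/
structure IsGrounded (H : A →ₗ.[ℂ] A) : Prop where
  isSelfAdjoint : IsSelfAdjoint H
  groundEnergy : IsGLB {x : ℝ | ∃ ψ : H.domain, ‖(ψ : A)‖ = 1 ∧ x = (⟪(ψ : A), H ψ⟫_ℂ).re} 0

/-- The energy `⟨ψ, H ψ⟩ ∈ [0, ∞]` of an arbitrary vector `ψ` for a self-adjoint `H ≥ 0`, i.e. the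
closed quadratic form of `H` (equal to `‖H^{1/2} ψ‖²` if `ψ` is in the domain of `H^{1/2}` and to
`∞` otherwise). It is obtained from its values on the domain of `H` as the lower semicontinuous
envelope. -/
def vectorEnergy (H : A →ₗ.[ℂ] A) (ψ : A) : ℝ≥0∞ :=
  liminf (fun φ : H.domain => ENNReal.ofReal (⟪(φ : A), H φ⟫_ℂ).re)
    (comap (fun φ : H.domain => (φ : A)) (𝓝 ψ))

/-- The energy `tr σ H = tr (σ^{1/2} H σ^{1/2}) = ∑ᵢ ⟨σ^{1/2} eᵢ, H σ^{1/2} eᵢ⟩ ∈ [0, ∞]` of a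
positive operator `σ` for a self-adjoint `H ≥ 0`. -/
def energy (H : A →ₗ.[ℂ] A) (σ : A →L[ℂ] A) : ℝ≥0∞ :=
  ∑' i, vectorEnergy H (CFC.sqrt σ (onb A i))

/-- `U` is the unitary group `U t = e^{-itH}` generated by the self-adjoint operator `H`: the
strongly continuous one-parameter unitary group whose infinitesimal generator is exactly `-iH`,
i.e. `ψ` is in the domain of `H` with `H ψ = φ` if and only if `t ↦ U t ψ` has derivative `-iφ`
at `0`. (For each self-adjoint `H` there is exactly one such `U`.) -/
structure IsTimeEvolution (H : A →ₗ.[ℂ] A) (U : ℝ → A →L[ℂ] A) : Prop where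
  mem_unitary : ∀ t, U t ∈ unitary (A →L[ℂ] A)
  map_add : ∀ s t, U (s + t) = U s * U t
  continuous : ∀ ψ, Continuous fun t => U t ψ
  generator : ∀ ψ φ : A, (ψ, φ) ∈ H.graph ↔
    HasDerivAt (fun t : ℝ => U t ψ) (-Complex.I • φ) 0

/-- The superoperator `X ↦ V X V†`. -/
def conjMap (V : A →L[ℂ] A) : (A →L[ℂ] A) →ₗ[ℂ] (A →L[ℂ] A) :=
  LinearMap.mulLeftRight ℂ (V, star V)

end SingleSystem

section Composite

variable {A B C : Type u}
  [NormedAddCommGroup A] [InnerProductSpace ℂ A] [CompleteSpace A]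
  [NormedAddCommGroup B] [InnerProductSpace ℂ B] [CompleteSpace B]
  [NormedAddCommGroup C] [InnerProductSpace ℂ C] [CompleteSpace C]

/-- The Hilbert space tensor product of `A` and `C`: the completion of the algebraic tensor
product in the inner product with `⟨a ⊗ c, a' ⊗ c'⟩ = ⟨a, a'⟩ ⟨c, c'⟩`. -/
abbrev HilbertTensor (A C : Type u) [NormedAddCommGroup A] [InnerProductSpace ℂ A]
    [NormedAddCommGroup C] [InnerProductSpace ℂ C] : Type u :=
  UniformSpace.Completion (A ⊗[ℂ] C)

/-- The operator `a ↦ a ⊗ c` from `A` to `A ⊗ C`, i.e. `𝟙 ⊗ |c⟩`. -/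
def tensorRight (A : Type u) [NormedAddCommGroup A] [InnerProductSpace ℂ A] (c : C) :
    A →L[ℂ] HilbertTensor A C :=
  UniformSpace.Completion.toComplL ∘L (TensorProduct.mkL ℂ A C).flip c

/-- The block `(𝟙 ⊗ ⟨c|) X (𝟙 ⊗ |c'⟩)` of an operator `X` on `A ⊗ C`, an operator on `A`. -/
def slice (c c' : C) (X : HilbertTensor A C →L[ℂ] HilbertTensor A C) : A →L[ℂ] A :=
  ContinuousLinearMap.adjoint (tensorRight A c) ∘L X ∘L tensorRight A c'

/-- The partial trace `ρ^A = tr_C ρ = ∑ⱼ (𝟙 ⊗ ⟨cⱼ|) ρ (𝟙 ⊗ |cⱼ⟩)` of a trace class operator `ρ` on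
`A ⊗ C`, for an orthonormal basis `cⱼ` of `C` (the sum converges in operator norm). -/
def partialTrace (ρ : HilbertTensor A C →L[ℂ] HilbertTensor A C) : A →L[ℂ] A :=
  ∑' j, slice (onb C j) (onb C j) ρ

/-- `σ = (Δ ⊗ id_C) ρ`: every block of `σ` is the image under `Δ` of that block of `ρ`. The blocks
determine `σ`. For trace class `ρ` all the blocks are trace class, so only the values of
`Δ` on trace class operators matter. -/
def IsAmpliation (Δ : (A →L[ℂ] A) →ₗ[ℂ] (B →L[ℂ] B))
    (ρ : HilbertTensor A C →L[ℂ] HilbertTensor A C)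
    (σ : HilbertTensor B C →L[ℂ] HilbertTensor B C) : Prop :=
  ∀ c c' : C, slice c c' σ = Δ (slice c c' ρ)

/-- The trace norm `‖(Δ ⊗ id_C) ρ‖₁`. As `(Δ ⊗ id_C) ρ` is unique, the infimum is over at most one
operator; it is `∞` if there is no bounded operator `(Δ ⊗ id_C) ρ`. -/
def ampliationTraceNorm (Δ : (A →L[ℂ] A) →ₗ[ℂ] (B →L[ℂ] B))
    (ρ : HilbertTensor A C →L[ℂ] HilbertTensor A C) : ℝ≥0∞ :=
  ⨅ (σ : HilbertTensor B C →L[ℂ] HilbertTensor B C) (_ : IsAmpliation Δ ρ σ), traceNorm σ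

/-- The `E`-constrained diamond norm with respect to the Hamiltonian `H` on `A`:
the supremum of `‖(Δ ⊗ id_C) ρ‖₁` over all separable Hilbert spaces `C` and all states `ρ` on
`A ⊗ C` with `tr ρ^A H ≤ E`. -/
def ecDiamondNorm (H : A →ₗ.[ℂ] A) (E : ℝ) (Δ : (A →L[ℂ] A) →ₗ[ℂ] (B →L[ℂ] B)) : ℝ≥0∞ :=
  ⨆ (C : Type u) (_ : NormedAddCommGroup C) (_ : InnerProductSpace ℂ C) (_ : CompleteSpace C)
    (_ : TopologicalSpace.SeparableSpace C)
    (ρ : HilbertTensor A C →L[ℂ] HilbertTensor A C) (_ : IsState ρ)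
    (_ : energy H (partialTrace ρ) ≤ ENNReal.ofReal E), ampliationTraceNorm Δ ρ

end Composite

end QuantumSpeed

end

/-! Everything rests on one estimate for vectors, `‖U t x - x‖² ≤ 2 t ⟨x, H x⟩`. On the domain of
`H` the derivative of the left side is controlled by positivity of the quadratic form of `H`
(`IsTimeEvolution.norm_sub_sq_le_of_mem_domain`); lower semicontinuity extends the bound to all
vectors. To pass to states, write `ρ = R²` with `R = √ρ`, and let `V`, `W` be `U t ⊗ 𝟙`, `U s ⊗ 𝟙`.
Then `V ρ V† - W ρ W†` telescopes into two products of Hilbert–Schmidt operators, each containing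
`(V - W) R`, and Hölder bounds its trace norm by `2 ‖(V - W) R‖₂` (`traceNorm_conj_sub_conj_le`).
That Hilbert–Schmidt norm depends only on the reduced state (`hsSq_tensorOne_comp_posSqrt`), so
summing the vector estimate over a basis gives `‖(V - W) R‖₂² ≤ 2 |t - s| E`. The resulting bound `2
min(1, √(2 |t - s| E))` implies the cube root estimate and uniform continuity; the speed limit is
the vector estimate applied to `ψ`. -/

open scoped ENNReal Topology TensorProduct InnerProductSpace
open Filter

noncomputable section

namespace QuantumSpeed

/-! ### Hilbert–Schmidt norms with values in `[0, ∞]`. -/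

section HilbertSchmidt

variable {ι κ E F G : Type*}
  [NormedAddCommGroup E] [InnerProductSpace ℂ E]
  [NormedAddCommGroup F] [InnerProductSpace ℂ F]
  [NormedAddCommGroup G] [InnerProductSpace ℂ G]

/-- The square of the Hilbert–Schmidt norm of `T`, computed in the basis `b`. -/
def hsSq (b : HilbertBasis ι ℂ E) (T : E →L[ℂ] F) : ℝ≥0∞ :=
  ∑' i, ENNReal.ofReal (‖T (b i)‖ ^ 2)

theorem ofReal_norm_sq_eq_tsum (b : HilbertBasis ι ℂ E) (x : E) :
    ENNReal.ofReal (‖x‖ ^ 2) = ∑' i, ENNReal.ofReal (‖⟪b i, x⟫_ℂ‖ ^ 2) := by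
  have h := Complex.hasSum_re (b.hasSum_inner_mul_inner x x)
  have h' : HasSum (fun i => ‖⟪b i, x⟫_ℂ‖ ^ 2) (‖x‖ ^ 2) := by
    convert h using 1
    · funext i
      rw [← inner_conj_symm x (b i), mul_comm, Complex.mul_conj, Complex.normSq_eq_norm_sq,
        Complex.ofReal_re]
    · exact (inner_self_eq_norm_sq (𝕜 := ℂ) x).symm
  rw [← h'.tsum_eq, ENNReal.ofReal_tsum_of_nonneg (fun i => by positivity) h'.summable]

/-- By Parseval both sides are the double sum of `|⟨b' j, T (b i)⟩|²`; in `[0, ∞]` the order of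
summation is free. Applied twice, this gives independence of the basis. -/
theorem hsSq_adjoint [CompleteSpace E] [CompleteSpace F] (b : HilbertBasis ι ℂ E)
    (b' : HilbertBasis κ ℂ F) (T : E →L[ℂ] F) :
    hsSq b' (ContinuousLinearMap.adjoint T) = hsSq b T := by
  simp only [hsSq, ofReal_norm_sq_eq_tsum b, ofReal_norm_sq_eq_tsum b']
  rw [ENNReal.tsum_comm]
  simp only [ContinuousLinearMap.adjoint_inner_right, norm_inner_symm (b' _)]

theorem hsSq_comp_le (b : HilbertBasis ι ℂ E) (V : F →L[ℂ] G) (hV : ‖V‖ ≤ 1) (T : E →L[ℂ] F) :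
    hsSq b (V ∘L T) ≤ hsSq b T := by
  refine ENNReal.tsum_le_tsum fun i => ENNReal.ofReal_le_ofReal ?_
  have : ‖V (T (b i))‖ ≤ ‖T (b i)‖ := by simpa using V.le_of_opNorm_le hV (T (b i))
  exact pow_le_pow_left₀ (norm_nonneg _) this 2

theorem hsSq_eq_hsSq [CompleteSpace E] [CompleteSpace F] (b : HilbertBasis ι ℂ E)
    (b' : HilbertBasis κ ℂ E) (T : E →L[ℂ] F) : hsSq b T = hsSq b' T := by
  obtain ⟨w, d, -⟩ := exists_hilbertBasis ℂ F
  rw [← hsSq_adjoint b d, hsSq_adjoint b' d]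

/-- Parseval gives `‖T x‖² = ∑ |⟨T† b' j, x⟩|²`, and Cauchy–Schwarz applies termwise. This makes the
partial trace converge in norm. -/
theorem ofReal_opNorm_sq_le_hsSq [CompleteSpace E] [CompleteSpace F] (b : HilbertBasis ι ℂ E)
    (T : E →L[ℂ] F) : ENNReal.ofReal (‖T‖ ^ 2) ≤ hsSq b T := by
  by_cases htop : hsSq b T = ⊤
  · simp [htop]
  obtain ⟨w, b', -⟩ := exists_hilbertBasis ℂ F
  have key : ∀ x, ENNReal.ofReal (‖T x‖ ^ 2) ≤ hsSq b T * ENNReal.ofReal (‖x‖ ^ 2) := by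
    intro x
    rw [ofReal_norm_sq_eq_tsum b', ← hsSq_adjoint b b', hsSq, ← ENNReal.tsum_mul_right]
    refine ENNReal.tsum_le_tsum fun i => ?_
    rw [← ENNReal.ofReal_mul (by positivity), ← mul_pow]
    refine ENNReal.ofReal_le_ofReal (pow_le_pow_left₀ (norm_nonneg _) ?_ 2)
    rw [← ContinuousLinearMap.adjoint_inner_left]
    exact norm_inner_le_norm _ _
  have hT : ‖T‖ ≤ Real.sqrt (hsSq b T).toReal := by
    refine T.opNorm_le_bound (Real.sqrt_nonneg _) fun x => ?_
    have hx := key x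
    rw [← ENNReal.ofReal_toReal htop, ← ENNReal.ofReal_mul ENNReal.toReal_nonneg,
      ENNReal.ofReal_le_ofReal_iff (by positivity)] at hx
    calc ‖T x‖ = Real.sqrt (‖T x‖ ^ 2) := (Real.sqrt_sq (norm_nonneg _)).symm
      _ ≤ Real.sqrt ((hsSq b T).toReal * ‖x‖ ^ 2) := Real.sqrt_le_sqrt hx
      _ = _ := by rw [Real.sqrt_mul ENNReal.toReal_nonneg, Real.sqrt_sq (norm_nonneg _)]
  rw [← ENNReal.ofReal_toReal htop]
  refine ENNReal.ofReal_le_ofReal ?_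
  calc ‖T‖ ^ 2 ≤ Real.sqrt (hsSq b T).toReal ^ 2 := pow_le_pow_left₀ (norm_nonneg _) hT 2
    _ = _ := Real.sq_sqrt ENNReal.toReal_nonneg

theorem sum_norm_mul_norm_le (b : HilbertBasis ι ℂ E) (S T : E →L[ℂ] F) {p q : ℝ}
    (hp : 0 ≤ p) (hq : 0 ≤ q) (hS : hsSq b S ≤ ENNReal.ofReal (p ^ 2))
    (hT : hsSq b T ≤ ENNReal.ofReal (q ^ 2)) (s : Finset ι) :
    ∑ i ∈ s, ‖S (b i)‖ * ‖T (b i)‖ ≤ p * q := by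
  have aux : ∀ (R : E →L[ℂ] F) {r : ℝ}, 0 ≤ r → hsSq b R ≤ ENNReal.ofReal (r ^ 2) →
      Real.sqrt (∑ i ∈ s, ‖R (b i)‖ ^ 2) ≤ r := by
    intro R r hr hR
    refine Real.sqrt_le_iff.2 ⟨hr, ?_⟩
    rw [← ENNReal.ofReal_le_ofReal_iff (by positivity),
      ENNReal.ofReal_sum_of_nonneg fun i _ => by positivity]
    exact (ENNReal.sum_le_tsum s).trans hR
  calc ∑ i ∈ s, ‖S (b i)‖ * ‖T (b i)‖
      ≤ Real.sqrt (∑ i ∈ s, ‖S (b i)‖ ^ 2) * Real.sqrt (∑ i ∈ s, ‖T (b i)‖ ^ 2) :=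
        Real.sum_mul_le_sqrt_mul_sqrt _ _ _
    _ ≤ p * q := mul_le_mul (aux S hp hS) (aux T hq hT) (Real.sqrt_nonneg _) hp

end HilbertSchmidt

/-! ### Trace norm, Hölder's inequality and square roots. -/

section TraceNorm

universe u

variable {K : Type u} [NormedAddCommGroup K] [InnerProductSpace ℂ K] [CompleteSpace K]

/-- For every `ε > 0` a self-adjoint operator `σ` has an approximate sign `V` such that
`|σ| ≤ V σ + ε`. -/
theorem exists_approx_sign {σ : K →L[ℂ] K} (hσ : IsSelfAdjoint σ) {ε : ℝ} (hε : 0 < ε) :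
    ∃ V : K →L[ℂ] K, IsSelfAdjoint V ∧ ‖V‖ ≤ 1 ∧
      CFC.sqrt (star σ * σ) ≤ V * σ + algebraMap ℝ (K →L[ℂ] K) ε := by
  -- The sign function is not continuous, so `x / ε` clipped to `[-1, 1]` replaces it; pointwise
  -- `|x| ≤ g x * x + ε`.
  set g : ℝ → ℝ := fun x => max (-1) (min 1 (x / ε)) with hg
  have hgc : Continuous g := by fun_prop
  refine ⟨cfc g σ, IsSelfAdjoint.cfc, norm_cfc_le zero_le_one fun x _ => ?_, ?_⟩
  · rw [Real.norm_eq_abs, abs_le]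
    exact ⟨le_max_left _ _, max_le (by norm_num) (min_le_left _ _)⟩
  · change CFC.abs σ ≤ _
    have h1 : cfc g σ * σ + algebraMap ℝ (K →L[ℂ] K) ε = cfc (fun x => g x * x + ε) σ := by
      rw [cfc_add σ (fun x => g x * x) (fun _ => ε) (by fun_prop) (by fun_prop), cfc_const ε σ hσ,
        cfc_mul g (fun x => x) σ (by fun_prop) (by fun_prop), cfc_id' ℝ σ hσ]
    rw [h1, CFC.abs_eq_cfc_norm σ hσ]
    refine cfc_mono (fun x _ => ?_) (by fun_prop) (by fun_prop)
    simp only [hg, Real.norm_eq_abs]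
    rcases le_total 1 (x / ε) with h | h
    · have hx : ε ≤ x := by rwa [le_div_iff₀ hε, one_mul] at h
      rw [min_eq_left h, max_eq_right (by norm_num), abs_of_pos (by linarith)]
      linarith
    · rw [min_eq_right h]
      rcases le_total (x / ε) (-1) with h' | h'
      · have hx : x ≤ -ε := by rw [div_le_iff₀ hε] at h'; linarith
        rw [max_eq_left h', abs_of_neg (by linarith)]
        linarith
      · have hx : |x| ≤ ε := by
          rw [div_le_iff₀ hε] at h
          rw [le_div_iff₀ hε] at h'
          exact abs_le.2 ⟨by linarith, by linarith⟩
        rw [max_eq_right h']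
        have : 0 ≤ x / ε * x := by
          rw [div_mul_eq_mul_div]
          exact div_nonneg (mul_self_nonneg x) hε.le
        linarith

/-- Hölder's inequality for the trace norm of `P₁ Q₁† + P₂ Q₂†`, if this is self-adjoint. -/
theorem traceNorm_le_of_eq_add {σ P₁ Q₁ P₂ Q₂ : K →L[ℂ] K} (hσ : IsSelfAdjoint σ)
    (h : σ = P₁ * star Q₁ + P₂ * star Q₂) {p₁ q₁ p₂ q₂ : ℝ}
    (hp₁ : 0 ≤ p₁) (hq₁ : 0 ≤ q₁) (hp₂ : 0 ≤ p₂) (hq₂ : 0 ≤ q₂)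
    (hP₁ : hsSq (onb K) P₁ ≤ ENNReal.ofReal (p₁ ^ 2))
    (hQ₁ : hsSq (onb K) Q₁ ≤ ENNReal.ofReal (q₁ ^ 2))
    (hP₂ : hsSq (onb K) P₂ ≤ ENNReal.ofReal (p₂ ^ 2))
    (hQ₂ : hsSq (onb K) Q₂ ≤ ENNReal.ofReal (q₂ ^ 2)) :
    traceNorm σ ≤ ENNReal.ofReal (p₁ * q₁ + p₂ * q₂) := by
  have hpos : (CFC.sqrt (star σ * σ)).IsPositive :=
    (ContinuousLinearMap.nonneg_iff_isPositive _).1 (CFC.sqrt_nonneg _)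
  rw [traceNorm, posTrace, ENNReal.tsum_eq_iSup_sum]
  refine iSup_le fun s => ?_
  rw [← ENNReal.ofReal_sum_of_nonneg
    (f := fun i => (⟪onb K i, CFC.sqrt (star σ * σ) (onb K i)⟫_ℂ).re)
    fun i _ => hpos.re_inner_nonneg_right _]
  refine ENNReal.ofReal_le_ofReal (le_of_forall_pos_le_add fun δ hδ => ?_)
  -- Each of the `s.card` diagonal entries costs an error `ε`; in total at most `δ`.
  set ε : ℝ := δ / (s.card + 1) with hεdef
  have hε : 0 < ε := by positivity
  obtain ⟨V, hVs, hV, hle⟩ := exists_approx_sign hσ hε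
  have hVs' : ContinuousLinearMap.adjoint V = V := hVs
  -- Each diagonal entry of `V P Q†` is `⟨(V P)† eᵢ, Q† eᵢ⟩`, so Cauchy–Schwarz bounds the partial
  -- trace by Hilbert–Schmidt norms.
  have part : ∀ (P Q : K →L[ℂ] K) {p q : ℝ}, 0 ≤ p → 0 ≤ q →
      hsSq (onb K) P ≤ ENNReal.ofReal (p ^ 2) → hsSq (onb K) Q ≤ ENNReal.ofReal (q ^ 2) →
      ∑ i ∈ s, (⟪onb K i, V (P (star Q (onb K i)))⟫_ℂ).re ≤ p * q := by
    intro P Q p q hp hq hP hQ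
    have h1 : hsSq (onb K) (ContinuousLinearMap.adjoint (V ∘L P)) ≤ ENNReal.ofReal (p ^ 2) := by
      rw [hsSq_adjoint (onb K)]
      exact (hsSq_comp_le _ V hV P).trans hP
    have h2 : hsSq (onb K) (ContinuousLinearMap.adjoint Q) ≤ ENNReal.ofReal (q ^ 2) := by
      rwa [hsSq_adjoint (onb K)]
    refine le_trans (Finset.sum_le_sum fun i _ => ?_) (sum_norm_mul_norm_le _ _ _ hp hq h1 h2 s)
    have h3 : ⟪onb K i, V (P (star Q (onb K i)))⟫_ℂ =
        ⟪ContinuousLinearMap.adjoint (V ∘L P) (onb K i),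
          ContinuousLinearMap.adjoint Q (onb K i)⟫_ℂ := by
      rw [ContinuousLinearMap.adjoint_inner_left]; rfl
    rw [h3]
    exact (Complex.re_le_norm _).trans (norm_inner_le_norm _ _)
  have term : ∀ i, (⟪onb K i, CFC.sqrt (star σ * σ) (onb K i)⟫_ℂ).re ≤
      (⟪onb K i, V (P₁ (star Q₁ (onb K i)))⟫_ℂ).re +
        (⟪onb K i, V (P₂ (star Q₂ (onb K i)))⟫_ℂ).re + ε := by
    intro i
    have h4 := ((ContinuousLinearMap.le_def _ _).1 hle).re_inner_nonneg_right (onb K i)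
    have h5 : (V * σ + algebraMap ℝ (K →L[ℂ] K) ε - CFC.sqrt (star σ * σ)) (onb K i) =
        V (P₁ (star Q₁ (onb K i))) + V (P₂ (star Q₂ (onb K i))) + (ε : ℂ) • onb K i -
          CFC.sqrt (star σ * σ) (onb K i) := by
      rw [Algebra.algebraMap_eq_smul_one]
      conv_lhs => rw [show V * σ = V * (P₁ * star Q₁ + P₂ * star Q₂) by rw [← h]]
      simp
    rw [h5, inner_sub_right, inner_add_right, inner_add_right, inner_smul_right,
      inner_self_eq_norm_sq_to_K, (onb K).orthonormal.1 i] at h4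
    simp at h4
    linarith
  calc ∑ i ∈ s, (⟪onb K i, CFC.sqrt (star σ * σ) (onb K i)⟫_ℂ).re
      ≤ ∑ i ∈ s, ((⟪onb K i, V (P₁ (star Q₁ (onb K i)))⟫_ℂ).re +
        (⟪onb K i, V (P₂ (star Q₂ (onb K i)))⟫_ℂ).re + ε) := Finset.sum_le_sum fun i _ => term i
    _ ≤ p₁ * q₁ + p₂ * q₂ + s.card * ε := by
      rw [Finset.sum_add_distrib, Finset.sum_add_distrib, Finset.sum_const, nsmul_eq_mul]
      linarith [part P₁ Q₁ hp₁ hq₁ hP₁ hQ₁, part P₂ Q₂ hp₂ hq₂ hP₂ hQ₂]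
    _ ≤ p₁ * q₁ + p₂ * q₂ + δ := by
      have : (s.card : ℝ) * ε ≤ δ := by
        rw [hεdef, mul_div_assoc', div_le_iff₀ (by positivity)]
        nlinarith
      linarith

/-- The positive square root. -/
def posSqrt (P : K →L[ℂ] K) : K →L[ℂ] K := CFC.sqrt P

theorem adjoint_posSqrt (P : K →L[ℂ] K) :
    ContinuousLinearMap.adjoint (posSqrt P) = posSqrt P :=
  (CFC.sqrt_nonneg P).isSelfAdjoint

theorem posSqrt_mul_posSqrt {P : K →L[ℂ] K} (hP : P.IsPositive) : posSqrt P * posSqrt P = P :=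
  CFC.sqrt_mul_sqrt_self P ((ContinuousLinearMap.nonneg_iff_isPositive _).2 hP)

theorem norm_posSqrt_apply_sq {P : K →L[ℂ] K} (hP : P.IsPositive) (x : K) :
    ‖posSqrt P x‖ ^ 2 = (⟪x, P x⟫_ℂ).re := by
  have h2 : P x = posSqrt P (posSqrt P x) := congr($((posSqrt_mul_posSqrt hP).symm) x)
  rw [h2, ← ContinuousLinearMap.adjoint_inner_left, adjoint_posSqrt]
  exact (inner_self_eq_norm_sq (𝕜 := ℂ) _).symm

/-- `tr P = ‖√P‖²` (Hilbert–Schmidt) for positive `P`. -/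
theorem hsSq_posSqrt {P : K →L[ℂ] K} (hP : P.IsPositive) :
    hsSq (onb K) (posSqrt P) = posTrace P :=
  tsum_congr fun i => by rw [norm_posSqrt_apply_sq hP]

end TraceNorm

/-! ### Hilbert space tensor products, blocks and partial traces. -/

section Tensor

universe u

variable {ι κ : Type*} {A C : Type u}
  [NormedAddCommGroup A] [InnerProductSpace ℂ A]
  [NormedAddCommGroup C] [InnerProductSpace ℂ C]

theorem inner_tensorRight (a a' : A) (c c' : C) :
    ⟪tensorRight A c a, tensorRight A c' a'⟫_ℂ = ⟪a, a'⟫_ℂ * ⟪c, c'⟫_ℂ := by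
  change ⟪((a ⊗ₜ[ℂ] c : A ⊗[ℂ] C) : HilbertTensor A C),
    ((a' ⊗ₜ[ℂ] c' : A ⊗[ℂ] C) : HilbertTensor A C)⟫_ℂ = _
  rw [UniformSpace.Completion.inner_coe, TensorProduct.inner_tmul]

theorem orthonormal_tensorRight {v : ι → A} {w : κ → C} (hv : Orthonormal ℂ v)
    (hw : Orthonormal ℂ w) : Orthonormal ℂ fun p : ι × κ => tensorRight A (w p.2) (v p.1) := by
  classical
  rw [orthonormal_iff_ite] at *
  rintro ⟨i, j⟩ ⟨i', j'⟩
  rw [inner_tensorRight, hv, hw]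
  by_cases h : i = i' <;> by_cases h' : j = j' <;> simp [h, h']

/-- The closed span absorbs the factors one at a time: first all of `A` against a basis vector of
`C`, then all of `C`, then sums and limits. -/
theorem topologicalClosure_span_tensorRight (b : HilbertBasis ι ℂ A) (b' : HilbertBasis κ ℂ C) :
    ⊤ ≤ (Submodule.span ℂ
      (Set.range fun p : ι × κ => tensorRight A (b' p.2) (b p.1))).topologicalClosure := by
  set S := (Submodule.span ℂ
    (Set.range fun p : ι × κ => tensorRight A (b' p.2) (b p.1))).topologicalClosure
  have hS : IsClosed (S : Set (HilbertTensor A C)) := Submodule.isClosed_topologicalClosure _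
  have h1 : ∀ j a, tensorRight A (b' j) a ∈ S := by
    intro j a
    have : (⊤ : Submodule ℂ A) ≤ S.comap (tensorRight A (b' j)).toLinearMap := by
      rw [← b.dense_span]
      refine Submodule.topologicalClosure_minimal _ (Submodule.span_le.2 ?_)
        (hS.preimage (tensorRight A (b' j)).continuous)
      rintro _ ⟨i, rfl⟩
      exact Submodule.le_topologicalClosure _ (Submodule.subset_span ⟨(i, j), rfl⟩)
    exact this trivial
  have h2 : ∀ a c, tensorRight A c a ∈ S := by
    intro a c
    let f : C →L[ℂ] HilbertTensor A C :=
      UniformSpace.Completion.toComplL ∘L TensorProduct.mkL ℂ A C a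
    have : (⊤ : Submodule ℂ C) ≤ S.comap f.toLinearMap := by
      rw [← b'.dense_span]
      refine Submodule.topologicalClosure_minimal _ (Submodule.span_le.2 ?_)
        (hS.preimage f.continuous)
      rintro _ ⟨j, rfl⟩
      exact h1 j a
    exact this (x := c) trivial
  rintro x -
  induction x using UniformSpace.Completion.induction_on with
  | hp => exact hS
  | ih x =>
    induction x using TensorProduct.induction_on with
    | zero => rw [UniformSpace.Completion.coe_zero]; exact S.zero_mem
    | tmul a c => exact h2 a c
    | add x y hx hy =>
      rw [UniformSpace.Completion.coe_add]
      exact S.add_mem hx hy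

/-- The product basis of the Hilbert space tensor product. -/
def tensorBasis (b : HilbertBasis ι ℂ A) (b' : HilbertBasis κ ℂ C) :
    HilbertBasis (ι × κ) ℂ (HilbertTensor A C) :=
  HilbertBasis.mk (orthonormal_tensorRight b.orthonormal b'.orthonormal)
    (topologicalClosure_span_tensorRight b b')

theorem tensorBasis_apply (b : HilbertBasis ι ℂ A) (b' : HilbertBasis κ ℂ C) (p : ι × κ) :
    tensorBasis b b' p = tensorRight A (b' p.2) (b p.1) := by
  rw [tensorBasis, HilbertBasis.coe_mk]

variable [CompleteSpace A] [CompleteSpace C]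

theorem ext_inner_tensorRight {x y : HilbertTensor A C}
    (h : ∀ (a : A) (c : C), ⟪tensorRight A c a, x⟫_ℂ = ⟪tensorRight A c a, y⟫_ℂ) : x = y := by
  refine (tensorBasis (onb A) (onb C)).repr.injective (lp.ext (funext fun p => ?_))
  rw [HilbertBasis.repr_apply_apply, HilbertBasis.repr_apply_apply, tensorBasis_apply]
  exact h _ _

/-- `Y = X ⊗ 𝟙`. -/
def IsTensorOne (X : A →L[ℂ] A) (Y : HilbertTensor A C →L[ℂ] HilbertTensor A C) : Prop :=
  ∀ (a : A) (c : C), Y (tensorRight A c a) = tensorRight A c (X a)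

omit [CompleteSpace A] [CompleteSpace C] in
theorem IsTensorOne.sub {X X' : A →L[ℂ] A} {Y Y' : HilbertTensor A C →L[ℂ] HilbertTensor A C}
    (h : IsTensorOne X Y) (h' : IsTensorOne X' Y') : IsTensorOne (X - X') (Y - Y') := by
  intro a c
  rw [sub_apply, h, h', sub_apply, map_sub]

theorem IsTensorOne.adjoint {X : A →L[ℂ] A} {Y : HilbertTensor A C →L[ℂ] HilbertTensor A C}
    (h : IsTensorOne X Y) :
    IsTensorOne (ContinuousLinearMap.adjoint X) (ContinuousLinearMap.adjoint Y) := by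
  intro a c
  refine ext_inner_tensorRight fun a' c' => ?_
  rw [ContinuousLinearMap.adjoint_inner_right, h, inner_tensorRight, inner_tensorRight,
    ContinuousLinearMap.adjoint_inner_right]

-- For unitary `V` the map `V ⊗ 𝟙` is isometric on the algebraic tensor product, hence extends to
-- the completion.
omit [CompleteSpace C] in
theorem exists_isTensorOne {V : A →L[ℂ] A} (hV : V ∈ unitary (A →L[ℂ] A)) :
    ∃ W : HilbertTensor A C →L[ℂ] HilbertTensor A C, IsTensorOne V W ∧ ‖W‖ ≤ 1 := by
  let L : A →ₗᵢ[ℂ] A := ⟨V.toLinearMap, ContinuousLinearMap.norm_map_of_mem_unitary hV⟩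
  let M : A ⊗[ℂ] C →ₗᵢ[ℂ] A ⊗[ℂ] C := TensorProduct.mapIsometry L LinearIsometry.id
  have hM : ∀ x : A ⊗[ℂ] C, M.toContinuousLinearMap.completion (x : HilbertTensor A C) =
      ((M x : A ⊗[ℂ] C) : HilbertTensor A C) := fun x =>
    UniformSpace.Completion.map_coe M.toContinuousLinearMap.uniformContinuous x
  refine ⟨M.toContinuousLinearMap.completion, fun a c => hM _,
    ContinuousLinearMap.opNorm_le_bound _ zero_le_one fun x => ?_⟩
  induction x using UniformSpace.Completion.induction_on with
  | hp => exact isClosed_le (by fun_prop) (by fun_prop)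
  | ih x => rw [hM, UniformSpace.Completion.norm_coe, UniformSpace.Completion.norm_coe,
      M.norm_map, one_mul]

/-- `V ⊗ 𝟙` slides past `𝟙 ⊗ |c⟩`. Hence `W ρ W†` is the ampliation of conjugation by `V`. -/
theorem slice_conj {V : A →L[ℂ] A} {W : HilbertTensor A C →L[ℂ] HilbertTensor A C}
    (h : IsTensorOne V W) (c c' : C) (ρ : HilbertTensor A C →L[ℂ] HilbertTensor A C) :
    slice c c' (W * ρ * star W) = conjMap V (slice c c' ρ) := by
  have h1 : ∀ d : C, ContinuousLinearMap.adjoint W ∘L tensorRight A d =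
      tensorRight A d ∘L ContinuousLinearMap.adjoint V := fun d =>
    ContinuousLinearMap.ext fun a => h.adjoint a d
  have h2 : ContinuousLinearMap.adjoint (tensorRight A c) ∘L W =
      V ∘L ContinuousLinearMap.adjoint (tensorRight A c) := by
    have := congr(ContinuousLinearMap.adjoint $(h1 c))
    simpa only [ContinuousLinearMap.adjoint_comp, ContinuousLinearMap.adjoint_adjoint] using this
  ext a
  have h3 := congr($(h1 c') a)
  have h4 := congr($h2 (ρ (tensorRight A c' (star V a))))
  simp only [ContinuousLinearMap.comp_apply] at h3 h4
  change ContinuousLinearMap.adjoint (tensorRight A c)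
    (W (ρ (ContinuousLinearMap.adjoint W (tensorRight A c' a)))) =
      V (ContinuousLinearMap.adjoint (tensorRight A c) (ρ (tensorRight A c' (star V a))))
  rw [h3]
  exact h4

omit [CompleteSpace C] in
theorem slice_sub (c c' : C) (X Y : HilbertTensor A C →L[ℂ] HilbertTensor A C) :
    slice c c' (X - Y) = slice c c' X - slice c c' Y := by
  ext a
  simp [slice]

variable {ρ : HilbertTensor A C →L[ℂ] HilbertTensor A C}

omit [CompleteSpace C] in
theorem slice_self_eq (hρ : ρ.IsPositive) (c : C) :
    slice c c ρ = ContinuousLinearMap.adjoint (posSqrt ρ ∘L tensorRight A c) ∘L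
      (posSqrt ρ ∘L tensorRight A c) := by
  rw [ContinuousLinearMap.adjoint_comp, adjoint_posSqrt, slice]
  conv_lhs => rw [← posSqrt_mul_posSqrt hρ]
  rfl

omit [CompleteSpace C] in
theorem re_inner_slice_self (hρ : ρ.IsPositive) (c : C) (x : A) :
    (⟪x, slice c c ρ x⟫_ℂ).re = ‖posSqrt ρ (tensorRight A c x)‖ ^ 2 := by
  rw [slice_self_eq hρ, ContinuousLinearMap.comp_apply, ContinuousLinearMap.adjoint_inner_right]
  exact inner_self_eq_norm_sq (𝕜 := ℂ) _

/-- The norm of a diagonal block is at most the squared Hilbert–Schmidt norm of `√ρ (𝟙 ⊗ |cⱼ⟩)`;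
these add up to `tr ρ = 1` in the product basis. -/
theorem summable_slice (hρ : IsState ρ) : Summable fun j => slice (onb C j) (onb C j) ρ := by
  refine Summable.of_norm ?_
  have h : ∑' j, ENNReal.ofReal ‖slice (onb C j) (onb C j) ρ‖ ≠ ⊤ := by
    refine ne_top_of_le_ne_top ENNReal.one_ne_top ?_
    calc ∑' j, ENNReal.ofReal ‖slice (onb C j) (onb C j) ρ‖
        ≤ ∑' j, hsSq (onb A) (posSqrt ρ ∘L tensorRight A (onb C j)) := by
          refine ENNReal.tsum_le_tsum fun j => ?_
          rw [slice_self_eq hρ.isPositive, ContinuousLinearMap.norm_adjoint_comp_self, ← sq]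
          exact ofReal_opNorm_sq_le_hsSq _ _
      _ = hsSq (tensorBasis (onb A) (onb C)) (posSqrt ρ) := by
          simp only [hsSq, tensorBasis_apply]
          rw [ENNReal.tsum_prod', ENNReal.tsum_comm]
          rfl
      _ = 1 := by
          rw [hsSq_eq_hsSq _ (onb _), hsSq_posSqrt hρ.isPositive, hρ.posTrace_eq_one]
  refine (ENNReal.summable_toReal h).congr fun j => ?_
  rw [ENNReal.toReal_ofReal (norm_nonneg _)]

theorem hasSum_partialTrace (hρ : IsState ρ) :
    HasSum (fun j => slice (onb C j) (onb C j) ρ) (partialTrace ρ) :=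
  (summable_slice hρ).hasSum

theorem isPositive_partialTrace (hρ : IsState ρ) : (partialTrace ρ).IsPositive := by
  rw [← ContinuousLinearMap.nonneg_iff_isPositive]
  refine (hasSum_partialTrace hρ).nonneg fun j => ?_
  rw [ContinuousLinearMap.nonneg_iff_isPositive, slice_self_eq hρ.isPositive]
  exact ContinuousLinearMap.isPositive_adjoint_comp_self _

theorem ofReal_norm_posSqrt_partialTrace_apply_sq (hρ : IsState ρ) (x : A) :
    ENNReal.ofReal (‖posSqrt (partialTrace ρ) x‖ ^ 2) =
      ∑' j, ENNReal.ofReal (‖posSqrt ρ (tensorRight A (onb C j) x)‖ ^ 2) := by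
  have h : HasSum (fun j => (⟪x, slice (onb C j) (onb C j) ρ x⟫_ℂ).re)
      (⟪x, partialTrace ρ x⟫_ℂ).re :=
    (hasSum_partialTrace hρ).mapL
      (Complex.reCLM ∘L ((innerSL ℂ x) ∘L ContinuousLinearMap.apply ℂ A x).restrictScalars ℝ)
  simp only [re_inner_slice_self hρ.isPositive] at h
  rw [norm_posSqrt_apply_sq (isPositive_partialTrace hρ), ← h.tsum_eq,
    ENNReal.ofReal_tsum_of_nonneg (fun i => by positivity) h.summable]

/-- `tr ((X ⊗ 𝟙) ρ (X ⊗ 𝟙)†) = tr (X ρ^A X†)`. -/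
theorem hsSq_tensorOne_comp_posSqrt (hρ : IsState ρ) {X : A →L[ℂ] A}
    {Y : HilbertTensor A C →L[ℂ] HilbertTensor A C} (h : IsTensorOne X Y) :
    hsSq (onb _) (Y * posSqrt ρ) = hsSq (onb A) (X * posSqrt (partialTrace ρ)) := by
  -- After taking adjoints, `Y†` acts directly on the product basis as `X† ⊗ 𝟙`, and the sum over
  -- `C` reassembles `√(ρ^A)`.
  rw [← hsSq_adjoint (onb A) (onb A), ← hsSq_adjoint (onb _) (tensorBasis (onb A) (onb C))]
  simp only [ContinuousLinearMap.mul_def, ContinuousLinearMap.adjoint_comp, adjoint_posSqrt, hsSq,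
    ContinuousLinearMap.comp_apply, tensorBasis_apply, h.adjoint _ _,
    ofReal_norm_posSqrt_partialTrace_apply_sq hρ]
  rw [ENNReal.tsum_prod']

end Tensor

/-! ### Displacement of vectors under the time evolution. -/

section Dynamics

universe u

variable {A : Type u} [NormedAddCommGroup A] [InnerProductSpace ℂ A] [CompleteSpace A]
  {H : A →ₗ.[ℂ] A} {U : ℝ → A →L[ℂ] A}

theorem IsGrounded.inner_symm (hH : IsGrounded H) (x y : H.domain) :
    ⟪H x, (y : A)⟫_ℂ = ⟪(x : A), H y⟫_ℂ := by
  have h := LinearPMap.adjoint_isFormalAdjoint hH.isSelfAdjoint.dense_domain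
  rw [LinearPMap.isSelfAdjoint_def.1 hH.isSelfAdjoint] at h
  exact h x y

theorem IsGrounded.re_inner_nonneg (hH : IsGrounded H) (x : H.domain) :
    0 ≤ (⟪(x : A), H x⟫_ℂ).re := by
  by_cases hx : (x : A) = 0
  · simp [hx]
  have hn : ‖(x : A)‖ ≠ 0 := norm_ne_zero_iff.2 hx
  have h := hH.groundEnergy.1 ⟨((‖(x : A)‖⁻¹ : ℝ) : ℂ) • x, by
    rw [Submodule.coe_smul, norm_smul]; simp [hn], rfl⟩
  rw [H.map_smul, Submodule.coe_smul, inner_smul_left, inner_smul_right, Complex.conj_ofReal,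
    Complex.re_ofReal_mul, Complex.re_ofReal_mul] at h
  have hp : 0 < ‖(x : A)‖⁻¹ := by positivity
  by_contra! hc
  have := mul_neg_of_pos_of_neg hp (mul_neg_of_pos_of_neg hp hc)
  linarith

theorem IsTimeEvolution.norm_apply (hU : IsTimeEvolution H U) (t : ℝ) (x : A) :
    ‖U t x‖ = ‖x‖ :=
  ContinuousLinearMap.norm_map_of_mem_unitary (hU.mem_unitary t) x

theorem IsTimeEvolution.inner_apply_apply (hU : IsTimeEvolution H U) (t : ℝ) (x y : A) :
    ⟪U t x, U t y⟫_ℂ = ⟪x, y⟫_ℂ :=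
  ContinuousLinearMap.inner_map_map_of_mem_unitary (hU.mem_unitary t) x y

theorem IsTimeEvolution.zero (hU : IsTimeEvolution H U) : U 0 = 1 := by
  have h := hU.map_add 0 0
  rw [add_zero] at h
  calc U 0 = star (U 0) * U 0 * U 0 := by
        rw [Unitary.star_mul_self_of_mem (hU.mem_unitary 0), one_mul]
    _ = 1 := by rw [mul_assoc, ← h, Unitary.star_mul_self_of_mem (hU.mem_unitary 0)]

/-- The group is commutative, so differentiating `U s (U t x) = U t (U s x)` at `s = 0` shows that
`U t` preserves the graph of the generator. -/
theorem IsTimeEvolution.mem_graph (hU : IsTimeEvolution H U) {x y : A} (h : (x, y) ∈ H.graph)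
    (t : ℝ) : (U t x, U t y) ∈ H.graph := by
  rw [hU.generator] at h ⊢
  have h' := ((U t).restrictScalars ℝ).hasFDerivAt.comp_hasDerivAt (0 : ℝ) h
  rw [ContinuousLinearMap.coe_restrictScalars', map_smul] at h'
  convert h' using 1
  funext s
  change U s (U t x) = U t (U s x)
  rw [← mul_apply_eq_comp, ← mul_apply_eq_comp, ← hU.map_add,
    ← hU.map_add, add_comm]

theorem IsTimeEvolution.hasDerivAt (hU : IsTimeEvolution H U) (x : H.domain) (t : ℝ) :
    HasDerivAt (fun s => U s x) (-Complex.I • U t (H x)) t := by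
  have h := (hU.generator _ _).1 (hU.mem_graph (H.mem_graph x) t)
  have h0 : HasDerivAt (fun s => U s (U t x)) (-Complex.I • U t (H x)) (t - t) := by
    rwa [sub_self]
  have h' := HasDerivAt.comp_sub_const t t h0
  convert h' using 1
  funext s
  rw [← mul_apply_eq_comp, ← hU.map_add, sub_add_cancel]

omit [CompleteSpace A] in
theorem norm_sub_sq_eq_of_norm_eq {x y : A} (h : ‖y‖ = ‖x‖) :
    ‖y - x‖ ^ 2 = 2 * ‖x‖ ^ 2 - 2 * (⟪x, y⟫_ℂ).re := by
  have h1 := norm_sub_sq (𝕜 := ℂ) y x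
  rw [h, ← inner_conj_symm y x, RCLike.conj_re] at h1
  rw [h1]
  simp only [RCLike.re_to_complex]
  ring

/-- The squared displacement vanishes at time `0`, and its derivative never exceeds `2 ⟨x, H x⟩`;
the mean value inequality concludes. -/
theorem IsTimeEvolution.norm_sub_sq_le_of_mem_domain (hH : IsGrounded H)
    (hU : IsTimeEvolution H U) (x : H.domain) {t : ℝ} (ht : 0 ≤ t) :
    ‖U t x - x‖ ^ 2 ≤ 2 * t * (⟪(x : A), H x⟫_ℂ).re := by
  have hd : ∀ s : ℝ, HasDerivAt (fun s => 2 * ‖(x : A)‖ ^ 2 - 2 * (⟪(x : A), U s x⟫_ℂ).re)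
      (-(2 * (⟪(x : A), -Complex.I • U s (H x)⟫_ℂ).re)) s := by
    intro s
    have h1 : HasDerivAt (fun s => ⟪(x : A), U s x⟫_ℂ)
        (⟪(x : A), -Complex.I • U s (H x)⟫_ℂ) s := by
      simpa using (hasDerivAt_const s (x : A)).inner ℂ (hU.hasDerivAt x s)
    have h2 := (Complex.reCLM.hasFDerivAt.comp_hasDerivAt s h1).const_mul 2
    exact (h2.const_sub _)
  have hb : ∀ s : ℝ, -(2 * (⟪(x : A), -Complex.I • U s (H x)⟫_ℂ).re) ≤
      2 * (⟪(x : A), H x⟫_ℂ).re := by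
    intro s
    obtain ⟨y, hy, hHy⟩ := (LinearPMap.mem_graph_iff H).1 (hU.mem_graph (H.mem_graph x) s)
    simp only at hy hHy
    -- With `y = U s x`, which has the same energy as `x`, the cross terms of the form at `x - i y`
    -- are exactly minus the derivative to be bounded.
    have hpos := hH.re_inner_nonneg (x + (-Complex.I) • y)
    have hyy : (⟪(y : A), H y⟫_ℂ).re = (⟪(x : A), H x⟫_ℂ).re := by
      rw [hy, hHy, hU.inner_apply_apply]
    have hyx : (⟪(y : A), H x⟫_ℂ) = (starRingEnd ℂ) ⟪(x : A), H y⟫_ℂ := by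
      rw [← hH.inner_symm, inner_conj_symm]
    have him : (⟪H y, (x : A)⟫_ℂ).im = -(⟪(x : A), H y⟫_ℂ).im := by
      rw [← inner_conj_symm, Complex.conj_im]
    rw [H.map_add, H.map_smul, Submodule.coe_add, Submodule.coe_smul, inner_add_left,
      inner_add_right, inner_add_right, inner_smul_left, inner_smul_left, inner_smul_right,
      inner_smul_right, hyx] at hpos
    rw [← hHy, inner_smul_right]
    simp at hpos ⊢
    linarith
  have h := image_sub_le_mul_sub_of_deriv_le (fun s => (hd s).differentiableAt)
    (C := 2 * (⟪(x : A), H x⟫_ℂ).re) (fun s => (hd s).deriv.trans_le (hb s)) ht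
  simp only [← norm_sub_sq_eq_of_norm_eq (hU.norm_apply _ _), hU.zero] at h
  simp [← Complex.ofReal_pow] at h
  linarith

/-- Under the time evolution a vector of energy `e` moves by at most `√(2 |t| e)` in time `t`. -/
theorem IsTimeEvolution.ofReal_norm_sub_sq_le (hH : IsGrounded H) (hU : IsTimeEvolution H U)
    (x : A) {t : ℝ} (ht : 0 ≤ t) :
    ENNReal.ofReal (‖U t x - x‖ ^ 2) ≤ ENNReal.ofReal (2 * t) * vectorEnergy H x := by
  -- The displacement is continuous, so any `c` strictly below its value at `x` stays below it
  -- nearby, and the bound on the domain carries `c` under the liminf.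
  have key : ∀ c < ENNReal.ofReal (‖U t x - x‖ ^ 2),
      c ≤ ENNReal.ofReal (2 * t) * vectorEnergy H x := by
    intro c hc
    have hcont : Continuous fun y => ENNReal.ofReal (‖U t y - y‖ ^ 2) :=
      ENNReal.continuous_ofReal.comp (by fun_prop)
    have hev : ∀ᶠ y in 𝓝 x, c < ENNReal.ofReal (‖U t y - y‖ ^ 2) :=
      hcont.continuousAt.eventually (lt_mem_nhds hc)
    rcases ht.eq_or_lt with rfl | ht'
    · simp [hU.zero] at hc
    have h0 : ENNReal.ofReal (2 * t) ≠ 0 := by simpa using ht'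
    rw [vectorEnergy, mul_comm, ← ENNReal.div_le_iff_le_mul (.inl h0) (.inl ENNReal.ofReal_ne_top)]
    refine le_liminf_of_le (by isBoundedDefault) ?_
    filter_upwards [tendsto_comap.eventually hev] with y hy
    rw [ENNReal.div_le_iff_le_mul (.inl h0) (.inl ENNReal.ofReal_ne_top), mul_comm,
      ← ENNReal.ofReal_mul (by positivity)]
    exact hy.le.trans (ENNReal.ofReal_le_ofReal (hU.norm_sub_sq_le_of_mem_domain hH y ht))
  exact le_of_forall_lt_imp_le_of_dense key

theorem IsTimeEvolution.ofReal_norm_sub_sq_le_abs (hH : IsGrounded H) (hU : IsTimeEvolution H U)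
    (x : A) (s t : ℝ) :
    ENNReal.ofReal (‖U t x - U s x‖ ^ 2) ≤
      ENNReal.ofReal (2 * |t - s|) * vectorEnergy H x := by
  wlog h : s ≤ t generalizing s t
  · rw [norm_sub_rev, abs_sub_comm]
    exact this t s (le_of_not_ge h)
  have h1 : U t x - U s x = U s (U (t - s) x - x) := by
    rw [map_sub, ← mul_apply_eq_comp, ← hU.map_add, add_sub_cancel]
  rw [h1, hU.norm_apply, abs_of_nonneg (sub_nonneg.2 h)]
  exact hU.ofReal_norm_sub_sq_le hH x (sub_nonneg.2 h)

end Dynamics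

/-! ### The energy-constrained diamond norm bound. -/

section Diamond

universe u

variable {A C : Type u}
  [NormedAddCommGroup A] [InnerProductSpace ℂ A] [CompleteSpace A]
  [NormedAddCommGroup C] [InnerProductSpace ℂ C] [CompleteSpace C]
  {H : A →ₗ.[ℂ] A} {U : ℝ → A →L[ℂ] A}

/-- The trace distance of two conjugates of a positive operator `R²` of trace at most one, for `R`
self-adjoint. -/
theorem traceNorm_conj_sub_conj_le {R V W : C →L[ℂ] C} (hR : star R = R)
    (hR1 : hsSq (onb C) R ≤ 1) (hV : ‖V‖ ≤ 1) (hW : ‖W‖ ≤ 1) {d : ℝ} (hd : 0 ≤ d)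
    (h : hsSq (onb C) ((V - W) * R) ≤ ENNReal.ofReal (d ^ 2)) :
    traceNorm (V * (R * R) * star V - W * (R * R) * star W) ≤ ENNReal.ofReal (2 * min 1 d) := by
  have hVR : hsSq (onb C) (V * R) ≤ ENNReal.ofReal (1 ^ 2) := by
    rw [one_pow, ENNReal.ofReal_one]
    exact (hsSq_comp_le (onb C) V hV R).trans hR1
  have hWR : hsSq (onb C) (W * R) ≤ ENNReal.ofReal (1 ^ 2) := by
    rw [one_pow, ENNReal.ofReal_one]
    exact (hsSq_comp_le (onb C) W hW R).trans hR1
  have hWR' : hsSq (onb C) (-(W * R)) ≤ ENNReal.ofReal (1 ^ 2) := by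
    simpa [hsSq] using hWR
  have hsa : IsSelfAdjoint (V * (R * R) * star V - W * (R * R) * star W) := by
    simp only [IsSelfAdjoint, star_sub, star_mul, star_star, hR, mul_assoc]
  rcases le_total 1 d with h1 | h1
  -- The trivial bound `2`, from `V R (V R)† - W R (W R)†`.
  · rw [min_eq_left h1]
    convert traceNorm_le_of_eq_add hsa ?_ zero_le_one zero_le_one zero_le_one zero_le_one
      hVR hVR hWR' hWR using 2
    · norm_num
    · simp only [star_mul, hR, neg_mul, mul_assoc, sub_eq_add_neg]
  -- Telescoping: `(V - W) R (V R)† + W R ((V - W) R)†`.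
  · rw [min_eq_right h1]
    convert traceNorm_le_of_eq_add hsa ?_ hd zero_le_one zero_le_one hd h hVR hWR h using 2
    · ring
    · simp only [star_mul, star_sub, hR]
      noncomm_ring

theorem ampliationTraceNorm_le (hH : IsGrounded H) (hU : IsTimeEvolution H U) {E : ℝ}
    (hE : 0 ≤ E) {ρ : HilbertTensor A C →L[ℂ] HilbertTensor A C} (hρ : IsState ρ)
    (hρE : energy H (partialTrace ρ) ≤ ENNReal.ofReal E) (s t : ℝ) :
    ampliationTraceNorm (conjMap (U t) - conjMap (U s)) ρ ≤
      ENNReal.ofReal (2 * min 1 (Real.sqrt (2 * |t - s| * E))) := by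
  obtain ⟨V, hV, hV1⟩ := exists_isTensorOne (C := C) (hU.mem_unitary t)
  obtain ⟨W, hW, hW1⟩ := exists_isTensorOne (C := C) (hU.mem_unitary s)
  refine (iInf₂_le (V * ρ * star V - W * ρ * star W) fun c c' => ?_).trans ?_
  · rw [slice_sub, slice_conj hV, slice_conj hW, LinearMap.sub_apply]
  · rw [← posSqrt_mul_posSqrt hρ.isPositive]
    refine traceNorm_conj_sub_conj_le (adjoint_posSqrt ρ) ?_ hV1 hW1 (Real.sqrt_nonneg _) ?_
    · rw [hsSq_posSqrt hρ.isPositive, hρ.posTrace_eq_one]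
    · rw [hsSq_tensorOne_comp_posSqrt hρ (hV.sub hW), Real.sq_sqrt (by positivity),
        ENNReal.ofReal_mul (by positivity)]
      calc hsSq (onb A) ((U t - U s) * posSqrt (partialTrace ρ))
          ≤ ∑' i, ENNReal.ofReal (2 * |t - s|) *
              vectorEnergy H (posSqrt (partialTrace ρ) (onb A i)) :=
            ENNReal.tsum_le_tsum fun i => hU.ofReal_norm_sub_sq_le_abs hH _ s t
        _ = ENNReal.ofReal (2 * |t - s|) * energy H (partialTrace ρ) := ENNReal.tsum_mul_left
        _ ≤ _ := by gcongr

theorem ecDiamondNorm_le (hH : IsGrounded H) (hU : IsTimeEvolution H U) {E : ℝ}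
    (hE : 0 ≤ E) (s t : ℝ) :
    ecDiamondNorm H E (conjMap (U t) - conjMap (U s)) ≤
      ENNReal.ofReal (2 * min 1 (Real.sqrt (2 * |t - s| * E))) := by
  refine iSup_le fun C => iSup_le fun _ => iSup_le fun _ => iSup_le fun _ => iSup_le fun _ =>
    iSup_le fun ρ => iSup_le fun hρ => iSup_le fun hρE => ?_
  exact ampliationTraceNorm_le hH hU hE hρ hρE s t

/-- For `4x ≥ 1` the right side is at least `1`; for `4x ≤ 1` the smaller exponent `1/3` gives the
larger power. -/
theorem min_one_sqrt_le_cbrt {x : ℝ} (hx : 0 ≤ x) :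
    min 1 (Real.sqrt (2 * x)) ≤ (4 * x) ^ (1 / 3 : ℝ) := by
  rcases le_total 1 (4 * x) with h | h
  · exact (min_le_left _ _).trans (Real.one_le_rpow h (by norm_num))
  · refine (min_le_right _ _).trans ((Real.sqrt_le_sqrt (by linarith : 2 * x ≤ 4 * x)).trans ?_)
    rw [Real.sqrt_eq_rpow]
    rcases hx.eq_or_lt with rfl | hx'
    · norm_num
    · exact Real.rpow_le_rpow_of_exponent_ge (by positivity) h (by norm_num)

end Diamond

end QuantumSpeed

end

theorem mainTheorem3 {A : Type*} [NormedAddCommGroup A] [InnerProductSpace ℂ A] [CompleteSpace A]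
    [TopologicalSpace.SeparableSpace A]
    (H : A →ₗ.[ℂ] A) (hH : QuantumSpeed.IsGrounded H)
    (U : ℝ → A →L[ℂ] A) (hU : QuantumSpeed.IsTimeEvolution H U)
    (E : ℝ) (hE : 0 ≤ E) :
    (∀ t : ℝ, 0 ≤ t →
      1 / 2 * QuantumSpeed.ecDiamondNorm H E
          (QuantumSpeed.conjMap (U t) - QuantumSpeed.conjMap (U 0)) ≤
        ENNReal.ofReal ((4 * t * E) ^ (1 / 3 : ℝ))) ∧
    (∀ ε : ℝ, 0 < ε → ∃ δ : ℝ, 0 < δ ∧ ∀ s t : ℝ, |t - s| < δ →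
      QuantumSpeed.ecDiamondNorm H E
          (QuantumSpeed.conjMap (U t) - QuantumSpeed.conjMap (U s)) < ENNReal.ofReal ε) ∧
    (∀ (ψ : A) (t : ℝ), ‖ψ‖ = 1 → QuantumSpeed.vectorEnergy H ψ ≤ ENNReal.ofReal E →
      0 ≤ t → ⟪ψ, U t ψ⟫_ℂ = 0 → 1 ≤ 4 * t * E) := by
  refine ⟨fun t ht => ?_, fun ε hε => ?_, fun ψ t hψ hψE ht h0 => ?_⟩
  · calc _ ≤ 1 / 2 * ENNReal.ofReal (2 * min 1 (Real.sqrt (2 * |t - 0| * E))) := by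
          gcongr
          exact QuantumSpeed.ecDiamondNorm_le hH hU hE 0 t
      _ = ENNReal.ofReal (min 1 (Real.sqrt (2 * (t * E)))) := by
          rw [ENNReal.ofReal_mul zero_le_two, ← mul_assoc, ENNReal.ofReal_ofNat, one_div,
            ENNReal.inv_mul_cancel (by norm_num) (by norm_num), one_mul, sub_zero,
            abs_of_nonneg ht, mul_assoc]
      _ ≤ _ := by
          rw [mul_assoc]
          exact ENNReal.ofReal_le_ofReal
            (QuantumSpeed.min_one_sqrt_le_cbrt (mul_nonneg ht hE))
  -- This `δ` makes `2 |t - s| E < ε² / 4`; the `+ 1` covers `E = 0`.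
  · refine ⟨ε ^ 2 / (8 * (E + 1)), by positivity, fun s t hst => ?_⟩
    refine (QuantumSpeed.ecDiamondNorm_le hH hU hE s t).trans_lt
      ((ENNReal.ofReal_lt_ofReal_iff hε).2 ?_)
    have h1 : Real.sqrt (2 * |t - s| * E) < ε / 2 := by
      rw [Real.sqrt_lt' (by positivity)]
      rw [lt_div_iff₀ (by positivity)] at hst
      nlinarith [abs_nonneg (t - s), sq_nonneg ε]
    linarith [min_le_right (1 : ℝ) (Real.sqrt (2 * |t - s| * E))]
  -- Orthogonality makes the squared displacement `2`, so in fact `1 ≤ t E`.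
  · have h1 := hU.ofReal_norm_sub_sq_le hH ψ ht
    rw [QuantumSpeed.norm_sub_sq_eq_of_norm_eq (hU.norm_apply t ψ), hψ, h0] at h1
    have h2 := h1.trans (mul_le_mul_right hψE _)
    rw [← ENNReal.ofReal_mul (by positivity), ENNReal.ofReal_le_ofReal_iff (by positivity)] at h2
    simp at h2
    nlinarith [mul_nonneg ht hE]
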